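/- Let $K$ be a field, $S=K[x_1,\dots,x_n]$ with its standard $\mathbb Z^n$-grading, and let $I\subset S$ be a nonzero proper monomial ideal that is minimally generated by $m$ monomials. Let $k$ be the maximal height of a prime ideal in $\operatorname{Ass}(S/I)$, and let $s\ge k$ be an integer. For a $\mathbb Z^n$-graded $S$-module $M$, a Stanley decomposition of $M$ is a finite direct sum decomposition $\mathcal D:\ M=\bigoplus_{i=1}^r m_iK[Z_i]$ of $K$-vector spaces, where each $m_i\in M$ is homogeneous, $Z_i\subset\{x_1,\dots,x_n\}$, and $m_iK[Z_i]$ is a free $K[Z_i]$-module with basis $m_i$. Put $\operatorname{sdepth}(\mathcal D)=\min_i|Z_i|$, and let $\operatorname{sdepth}(M)$ be the maximum of $\operatorname{sdepth}(\mathcal D)$ over all Stanley decompositions $\mathcal D$ of $M$. Let $\operatorname{depth}(M)$ be the maximal length of an $M$-regular sequence in $(x_1,\dots,x_n)$. Stanley's conjecture for $M$ is the inequality $\operatorname{depth}(M)\le\operatorname{sdepth}(M)$. Consider the conditions $$(1)\quad m\le s-1+\left\lceil\frac{s}{k-1}\right\rceil,\qquad\qquad (2)\quad m\le 2s-3+\left\lceil\frac{2s-2}{k-1}\right\rceil,$$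 where, if $k=1$ (the fractions are then undefined), both conditions are regarded as satisfied. * If (1) holds, then $\operatorname{sdepth}(S/I)\ge n-s$. * If (2) holds, then $\operatorname{sdepth}(I)\ge n-s+1$. * Suppose that $\operatorname{depth}(S/I)=n-s$. If (1) holds, then Stanley's conjecture holds for $S/I$; if (2) holds, then Stanley's conjecture holds for $I$. -/

import Mathlib

open MvPolynomial

noncomputable section

namespace StanleyDepth

variable {n : ℕ} {K : Type*} [Field K]

/-- The standard `ℤⁿ`-grading of `S = K[x₁,…,xₙ]`: the component of degree `a` consists of the
scalar multiples of `x ^ a` (it is `0` if `a` has a negative entry). -/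
def fineGrading (n : ℕ) (K : Type*) [Field K] (a : Fin n → ℤ) :
    Submodule K (MvPolynomial (Fin n) K) where
  carrier := {p | ∀ d : Fin n →₀ ℕ, p.coeff d ≠ 0 → ∀ i, (d i : ℤ) = a i}
  zero_mem' := by intro d hd; simp at hd
  add_mem' := by
    intro p q hp hq d hd
    by_cases h : p.coeff d = 0
    · exact hq d (by simpa [h] using hd)
    · exact hp d h
  smul_mem' := by
    intro c p hp d hd
    refine hp d fun h => hd ?_
    simp [h]

/-- The `ℤⁿ`-grading that a (monomial) ideal `I ⊆ S` inherits from `S`. -/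
def idealGrading (I : Ideal (MvPolynomial (Fin n) K)) (a : Fin n → ℤ) : Submodule K I :=
  (fineGrading n K a).comap ((Submodule.subtype I).restrictScalars K)

/-- The `ℤⁿ`-grading that `S ⧸ I`, with `I` a (monomial) ideal, inherits from `S`. -/
def quotientGrading (I : Ideal (MvPolynomial (Fin n) K)) (a : Fin n → ℤ) :
    Submodule K (MvPolynomial (Fin n) K ⧸ I) :=
  (fineGrading n K a).map (Ideal.Quotient.mkₐ K I).toLinearMap

section Modules

variable {M : Type*} [AddCommGroup M] [Module K M] [Module (MvPolynomial (Fin n) K) M]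
  [IsScalarTower K (MvPolynomial (Fin n) K) M]

/-- The `K`-subspace `u K[Z]` of `M`, where `K[Z]` is the polynomial subring of `S` on the
variables in `Z`. -/
def stanleySpace (u : M) (Z : Finset (Fin n)) : Submodule K M :=
  (Subalgebra.toSubmodule (supported K (Z : Set (Fin n)))).map
    ((LinearMap.toSpanSingleton (MvPolynomial (Fin n) K) M u).restrictScalars K)

/-- A Stanley decomposition of a `ℤⁿ`-graded `S`-module `M` with graded components `ℳ a`: a
finite direct sum decomposition `M = ⨁ᵢ mᵢ K[Zᵢ]` of `K`-vector spaces, with `mᵢ ∈ M` homogeneous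
and `mᵢ K[Zᵢ]` a free `K[Zᵢ]`-module with basis `mᵢ`. -/
structure StanleyDecomposition (ℳ : (Fin n → ℤ) → Submodule K M) where
  r : ℕ
  m : Fin r → M
  Z : Fin r → Finset (Fin n)
  homogeneous : ∀ i, ∃ a, m i ∈ ℳ a
  free : ∀ i, Function.Injective fun f : supported K (Z i : Set (Fin n)) =>
    (f : MvPolynomial (Fin n) K) • m i
  isInternal : DirectSum.IsInternal fun i => stanleySpace (K := K) (m i) (Z i)

/-- The Stanley depth of a decomposition, `minᵢ |Zᵢ|` (it is `⊤` for the empty decomposition,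
which only the zero module has). -/
def StanleyDecomposition.sdepth {ℳ : (Fin n → ℤ) → Submodule K M}
    (D : StanleyDecomposition ℳ) : ℕ∞ :=
  ⨅ i, ((D.Z i).card : ℕ∞)

/-- The Stanley depth of a `ℤⁿ`-graded `S`-module with graded components `ℳ a`: the maximum of
the Stanley depths of its Stanley decompositions. -/
def sdepth (ℳ : (Fin n → ℤ) → Submodule K M) : ℕ∞ :=
  ⨆ D : StanleyDecomposition ℳ, D.sdepth

end Modules

/-- The depth of an `S`-module `M`: the supremum of the lengths of the `M`-regular sequences in
the ideal `(x₁,…,xₙ)`. -/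
def depth (n : ℕ) (K : Type*) [Field K] (M : Type*) [AddCommGroup M]
    [Module (MvPolynomial (Fin n) K) M] : ℕ∞ :=
  ⨆ (rs : List (MvPolynomial (Fin n) K)) (_ : ∀ f ∈ rs, f ∈ idealOfVars (Fin n) K)
    (_ : RingTheory.Sequence.IsRegular M rs), (rs.length : ℕ∞)

/-- The ideal of `S` generated by the monomials `x ^ d`, `d ∈ G`. -/
def monomialSpan (K : Type*) [Field K] (G : Finset (Fin n →₀ ℕ)) :
    Ideal (MvPolynomial (Fin n) K) :=
  Ideal.span ((fun d => monomial d (1 : K)) '' (G : Set (Fin n →₀ ℕ)))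

/-- `I` is minimally generated by the monomials with exponent vectors in `G`: they generate `I`,
and no proper subset of them does. -/
def IsMinimallyGeneratedBy (I : Ideal (MvPolynomial (Fin n) K)) (G : Finset (Fin n →₀ ℕ)) :
    Prop :=
  monomialSpan K G = I ∧ ∀ G' ⊂ G, monomialSpan K G' ≠ I

end StanleyDepth

end

open MvPolynomial

noncomputable section

namespace StanleyDepth

variable {n : ℕ} {K : Type*} [Field K]

/-! The set of monomials outside `I` (for `S/I`), or inside it (for `I`), is cut into finitely many
disjoint boxes `a + ℕ^Z`; each box is a summand `x^a K[Z]`, so boxes of codimension at most `c` give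
sdepth at least `n - c` (`le_sdepth_of_boxPartition`).

Two partitions work for any generators. Avoiding `j` generators inside a box costs at most `j`
directions (`avoid`). The part of a box inside an ideal with `m'` generators costs only `⌊m'/2⌋`
(`ideal`), by sorting its monomials according to a parse of the cyclic word that records which
generators divide them.

The heights enter through slicing (`of_colonsHitBy`). While the corner `u` of a full-dimensional box
is not in `I`, the proper colon ideal `I : x^u` lies in an associated prime, which contains at most
`k` variables. Hence some variable `x_i` has `u_i < g_i` for at least a `1/k` share of the `m`
generators `g`. On the slice `d_i = u_i` these generators are irrelevant, so only `m' ≤ m(k-1)/k`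
are left; then the corner moves to `u + e_i`. Conditions (1) and (2) say `m(k-1)/k < s` and
`m(k-1)/k < 2(s-1)`, which is what the slices need. Stanley's inequality for `I` then follows from
`depth I ≤ depth S/I + 1` (`depth_ideal_le`). -/

/-! ### Boxes of monomials and partitions into boxes -/

/-- The exponent vectors of the monomials in `x ^ a K[Z]`. -/
def box (a : Fin n →₀ ℕ) (Z : Finset (Fin n)) : Set (Fin n →₀ ℕ) :=
  {d | ∀ i, a i ≤ d i ∧ (i ∉ Z → d i = a i)}

/-- `R` is a finite disjoint union of boxes of codimension at most `c`. -/
inductive BoxPartition (c : ℕ) : Set (Fin n →₀ ℕ) → Prop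
  | empty : BoxPartition c ∅
  | box (a : Fin n →₀ ℕ) (Z : Finset (Fin n)) (h : n ≤ Z.card + c) : BoxPartition c (box a Z)
  | union (R₁ R₂ : Set (Fin n →₀ ℕ)) (h₁ : BoxPartition c R₁) (h₂ : BoxPartition c R₂)
      (h : Disjoint R₁ R₂) : BoxPartition c (R₁ ∪ R₂)

theorem box_univ_zero : box (0 : Fin n →₀ ℕ) Finset.univ = Set.univ := by
  ext d; simp [box]

theorem box_eq_union {Z : Finset (Fin n)} {i : Fin n} (hi : i ∈ Z) (a : Fin n →₀ ℕ) :
    box a Z = box a (Z.erase i) ∪ box (a + Finsupp.single i 1) Z := by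
  classical
  ext d
  simp only [box, Set.mem_ofPred_eq, Set.mem_union, Finsupp.add_apply, Finsupp.single_apply,
    Finset.mem_erase]
  constructor
  · intro h
    by_cases hd : d i = a i
    · left
      intro j
      refine ⟨(h j).1, fun hj => ?_⟩
      by_cases hji : j = i
      · rw [hji, hd]
      · exact (h j).2 fun hjZ => hj ⟨hji, hjZ⟩
    · right
      intro j
      have := h j
      have := h i
      by_cases hji : i = j
      · subst hji
        simp [hi]; omega
      · simpa [hji] using h j
  · rintro (h | h) j
    · exact ⟨(h j).1, fun hj => (h j).2 fun h' => hj h'.2⟩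
    · have := h j
      by_cases hji : i = j
      · subst hji
        refine ⟨by omega, fun hj => absurd hi hj⟩
      · simpa [hji] using h j

theorem disjoint_box_erase (Z : Finset (Fin n)) (i : Fin n) (a : Fin n →₀ ℕ) :
    Disjoint (box a (Z.erase i)) (box (a + Finsupp.single i 1) Z) := by
  rw [Set.disjoint_left]
  intro d h₁ h₂
  have e₁ := (h₁ i).2 (by simp)
  have e₂ := (h₂ i).1
  simp at e₂
  omega

namespace BoxPartition

variable {c : ℕ}

theorem biUnion {ι : Type*} (s : Finset ι) (f : ι → Set (Fin n →₀ ℕ))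
    (h : ∀ i ∈ s, BoxPartition c (f i))
    (hd : ∀ i ∈ s, ∀ j ∈ s, i ≠ j → Disjoint (f i) (f j)) :
    BoxPartition c (⋃ i ∈ s, f i) := by
  classical
  induction s using Finset.induction_on with
  | empty => simpa using BoxPartition.empty
  | insert i s hi ih =>
    rw [Finset.set_biUnion_insert]
    refine union _ _ (h i (by simp)) (ih (fun j hj => h j (by simp [hj]))
      fun j hj l hl => hd j (by simp [hj]) l (by simp [hl])) ?_
    rw [Set.disjoint_iUnion₂_right]
    intro j hj
    exact hd i (by simp) j (by simp [hj]) fun e => hi (e ▸ hj)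

theorem exists_fin {R : Set (Fin n →₀ ℕ)} (h : BoxPartition c R) :
    ∃ (r : ℕ) (a : Fin r → Fin n →₀ ℕ) (Z : Fin r → Finset (Fin n)),
      (∀ i, n ≤ (Z i).card + c) ∧ (⋃ i, StanleyDepth.box (a i) (Z i)) = R ∧
      Pairwise fun i j => Disjoint (StanleyDepth.box (a i) (Z i)) (StanleyDepth.box (a j) (Z j)) := by
  induction h with
  | empty => exact ⟨0, Fin.elim0, Fin.elim0, fun i => i.elim0, by simp, fun i => i.elim0⟩
  | box a Z h =>
    exact ⟨1, fun _ => a, fun _ => Z, fun _ => h, Set.iUnion_const _, fun i j hij =>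
      absurd (Subsingleton.elim i j) hij⟩
  | union R₁ R₂ _ _ hR h₁ h₂ =>
    obtain ⟨r₁, a₁, Z₁, c₁, u₁, d₁⟩ := h₁
    obtain ⟨r₂, a₂, Z₂, c₂, u₂, d₂⟩ := h₂
    have s₁ : ∀ i, StanleyDepth.box (a₁ i) (Z₁ i) ⊆ R₁ := fun i => u₁ ▸
      Set.subset_iUnion (fun i => StanleyDepth.box (a₁ i) (Z₁ i)) i
    have s₂ : ∀ i, StanleyDepth.box (a₂ i) (Z₂ i) ⊆ R₂ := fun i => u₂ ▸
      Set.subset_iUnion (fun i => StanleyDepth.box (a₂ i) (Z₂ i)) i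
    refine ⟨r₁ + r₂, Fin.append a₁ a₂, Fin.append Z₁ Z₂, ?_, ?_, ?_⟩
    · intro i
      refine Fin.addCases (fun i => ?_) (fun i => ?_) i
      · simpa using c₁ i
      · simpa using c₂ i
    · rw [← u₁, ← u₂]
      ext d
      simp only [Set.mem_iUnion, Set.mem_union]
      constructor
      · rintro ⟨i, hi⟩
        revert hi
        refine Fin.addCases (fun i hi => ?_) (fun i hi => ?_) i
        · exact Or.inl ⟨i, by simpa using hi⟩
        · exact Or.inr ⟨i, by simpa using hi⟩
      · rintro (⟨i, hi⟩ | ⟨i, hi⟩)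
        · exact ⟨Fin.castAdd r₂ i, by simpa using hi⟩
        · exact ⟨Fin.natAdd r₁ i, by simpa using hi⟩
    · intro i j
      refine Fin.addCases (fun i => ?_) (fun i => ?_) i <;>
        refine Fin.addCases (fun j => ?_) (fun j => ?_) j <;>
        simp only [Fin.append_left, Fin.append_right] <;> intro hij
      · exact d₁ fun e => hij (by rw [e])
      · exact hR.mono (s₁ i) (s₂ j)
      · exact hR.symm.mono (s₂ i) (s₁ j)
      · exact d₂ fun e => hij (by rw [e])

/-- The monomials of a box outside a monomial ideal with few generators. -/
theorem avoid (J : Finset (Fin n →₀ ℕ)) (u : Fin n →₀ ℕ) (Y : Finset (Fin n))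
    (h : n + J.card ≤ Y.card + c) :
    BoxPartition c {d | d ∈ StanleyDepth.box u Y ∧ ∀ g ∈ J, ¬ g ≤ d} := by
  classical
  induction J using Finset.induction_on generalizing u Y with
  | empty => simpa using BoxPartition.box u Y (by simpa using h)
  | insert g J hg ih =>
    -- The corner is raised towards `g`. On each slice `d_i = u_i < g_i` split off, `g` cannot
    -- divide: one direction is lost and one generator disappears, which keeps the count balanced.
    rw [Finset.card_insert_of_notMem hg] at h
    induction hN : ∑ i, (g i - u i) using Nat.strong_induction_on generalizing u with
    | _ N ihN =>
    by_cases hgu : g ≤ u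
    · convert BoxPartition.empty
      rw [Set.eq_empty_iff_forall_notMem]
      rintro d ⟨hd, hd'⟩
      exact hd' g (by simp) fun i => (hgu i).trans (hd i).1
    · obtain ⟨i, hi⟩ : ∃ i, u i < g i := by
        by_contra! hcon
        exact hgu fun i => hcon i
      by_cases hiY : i ∈ Y
      · have hc := Finset.card_erase_add_one hiY
        have e : {d | d ∈ StanleyDepth.box u Y ∧ ∀ g' ∈ insert g J, ¬ g' ≤ d} =
            {d | d ∈ StanleyDepth.box u (Y.erase i) ∧ ∀ g' ∈ J, ¬ g' ≤ d} ∪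
            {d | d ∈ StanleyDepth.box (u + Finsupp.single i 1) Y ∧
              ∀ g' ∈ insert g J, ¬ g' ≤ d} := by
          rw [box_eq_union hiY u]
          ext d
          simp only [Set.mem_ofPred_eq, Set.mem_union, Finset.forall_mem_insert]
          have : d ∈ StanleyDepth.box u (Y.erase i) → ¬ g ≤ d := fun hd hgd => by
            have := (hd i).2 (by simp)
            have := hgd i
            omega
          tauto
        rw [e]
        refine union _ _ (ih u _ (by omega)) (ihN _ ?_ _ rfl) ?_
        · rw [← hN]
          refine Finset.sum_lt_sum (fun j _ => ?_) ⟨i, Finset.mem_univ i, ?_⟩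
          · simp only [Finsupp.add_apply]; omega
          · simp only [Finsupp.add_apply, Finsupp.single_eq_same]; omega
        · exact (disjoint_box_erase Y i u).mono (fun d hd => hd.1) fun d hd => hd.1
      · convert ih u Y (by omega) using 1
        ext d
        simp only [Set.mem_ofPred_eq, Finset.forall_mem_insert]
        have : d ∈ StanleyDepth.box u Y → ¬ g ≤ d := fun hd hgd => by
          have := (hd i).2 hiY
          have := hgd i
          omega
        tauto

/-- Divisibility conditions are free: `a ≤ d` replaces the corner `u` by `u ⊔ a`, or empties the box
when `a` exceeds `u` in a fixed coordinate. Only the generators to be avoided cost directions. -/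
theorem ge_and_avoid (X J : Finset (Fin n →₀ ℕ)) (u : Fin n →₀ ℕ) (Y : Finset (Fin n))
    (h : n + J.card ≤ Y.card + c) :
    BoxPartition c
      {d | d ∈ StanleyDepth.box u Y ∧ (∀ g ∈ X, g ≤ d) ∧ ∀ g ∈ J, ¬ g ≤ d} := by
  classical
  induction X using Finset.induction_on generalizing u with
  | empty => simpa using avoid J u Y h
  | insert a X _ ih =>
    by_cases ha : ∀ i ∉ Y, a i ≤ u i
    · convert ih (u ⊔ a) using 1
      ext d
      have : d ∈ StanleyDepth.box (u ⊔ a) Y ↔ d ∈ StanleyDepth.box u Y ∧ a ≤ d := by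
        simp only [StanleyDepth.box, Set.mem_ofPred_eq, Finsupp.sup_apply, Finsupp.le_def,
          ← forall_and]
        refine forall_congr' fun i => ?_
        by_cases hi : i ∈ Y
        · simp [hi]
        · simp [hi, ha i hi]
          intro _ h
          rw [h]
          exact ha i hi
      simp only [Set.mem_ofPred_eq, Finset.forall_mem_insert, this]
      tauto
    · push Not at ha
      obtain ⟨i, hi, hui⟩ := ha
      convert BoxPartition.empty
      rw [Set.eq_empty_iff_forall_notMem]
      rintro d ⟨hd, hd', -⟩
      have := hd' a (by simp) i
      have := (hd i).2 hi
      omega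

end BoxPartition

/-! ### Parsing cyclic words of odd length -/

section CyclicWords

variable {t : ℕ}

/-- A nonzero cyclic word of odd length is parsed into single ones and pairs that start with a
zero: every zero that is not the second letter of a pair is the first letter of a pair. Here `H`
is the set of the positions of the first letters of pairs. -/
def IsParse (b : ZMod (2 * t + 1) → Prop) (H : Finset (ZMod (2 * t + 1))) : Prop :=
  ∀ i, i + 1 ∈ H ↔ ¬ b (i + 1) ∧ i ∉ H

/-- Measure the cyclic distance back to the nearest one. It is zero at a one and grows by one at
each zero, so the positions at odd distance are the first letters of pairs. -/
theorem exists_isParse {b : ZMod (2 * t + 1) → Prop} (hb : ∃ i, b i) : ∃ H, IsParse b H := by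
  classical
  obtain ⟨i₀, hi₀⟩ := hb
  have key : ∀ i, ∃ l : ℕ, b (i - l) := fun i => ⟨(i - i₀).val, by simpa using hi₀⟩
  refine ⟨Finset.univ.filter fun i => Odd (Nat.find (key i)), fun i => ?_⟩
  simp only [Finset.mem_filter, Finset.mem_univ, true_and]
  by_cases h : b (i + 1)
  · have : Nat.find (key (i + 1)) = 0 := by
      rw [Nat.find_eq_zero]; simpa using h
    simp [this, h]
  · have h' : ∃ l : ℕ, b (i + 1 - ((l + 1 : ℕ) : ZMod (2 * t + 1))) := by
      obtain ⟨l, hl⟩ := key i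
      exact ⟨l, by convert hl using 1; push_cast; ring⟩
    have e := Nat.find_comp_succ (key (i + 1)) h' (by simpa using h)
    have e' : Nat.find h' = Nat.find (key i) := by
      congr 1
      funext l
      congr 1
      push_cast; ring
    rw [e, e']
    simp [h, Nat.odd_add_one]

theorem IsParse.notMem {b : ZMod (2 * t + 1) → Prop} {H : Finset (ZMod (2 * t + 1))}
    (h : IsParse b H) {i : ZMod (2 * t + 1)} (hi : b i) : i ∉ H := fun hiH => by
  have := h (i - 1)
  rw [sub_add_cancel] at this
  exact (this.1 hiH).1 hi

/-- A one is never in `H`, and from there the defining recursion determines membership all around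
the cycle. -/
theorem IsParse.unique {b : ZMod (2 * t + 1) → Prop} (hb : ∃ i, b i)
    {H H' : Finset (ZMod (2 * t + 1))} (h : IsParse b H) (h' : IsParse b H') : H = H' := by
  obtain ⟨i₀, hi₀⟩ := hb
  have : ∀ l : ℕ, i₀ + l ∈ H ↔ i₀ + l ∈ H' := by
    intro l
    induction l with
    | zero => simp [h.notMem hi₀, h'.notMem hi₀]
    | succ l ih =>
      push_cast
      rw [← add_assoc, h, h', ih]
  ext i
  simpa using this (i - i₀).val

/-- The pairs do not overlap. -/
def IsSparse (H : Finset (ZMod (2 * t + 1))) : Prop := ∀ i ∈ H, i + 1 ∉ H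

/-- For fixed `H`, parsing becomes a list of independent letter conditions: zeros on `H`, ones at
the single positions, and nothing on second letters of pairs. This is the form to which
`ge_and_avoid` applies. -/
theorem isParse_iff {b : ZMod (2 * t + 1) → Prop} {H : Finset (ZMod (2 * t + 1))} :
    IsParse b H ↔ IsSparse H ∧ (∀ i ∉ H, i + 1 ∉ H → b (i + 1)) ∧ ∀ i ∈ H, ¬ b i := by
  constructor
  · refine fun h => ⟨fun i hi hi' => ((h i).1 hi').2 hi, fun i hi hi' => ?_,
      fun i hi hb => h.notMem hb hi⟩
    by_contra hb
    exact hi' ((h i).2 ⟨hb, hi⟩)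
  · rintro ⟨h₁, h₂, h₃⟩ i
    refine ⟨fun hi => ⟨h₃ _ hi, fun hi' => h₁ i hi' hi⟩, fun hi => ?_⟩
    by_contra hi'
    exact hi.1 (h₂ i hi.2 hi')

theorem IsSparse.card_le {H : Finset (ZMod (2 * t + 1))} (h : IsSparse H) : H.card ≤ t := by
  classical
  have hd : Disjoint H (H.map (addRightEmbedding 1)) := by
    rw [Finset.disjoint_right]
    intro i hi hi'
    obtain ⟨j, hj, rfl⟩ := Finset.mem_map.1 hi
    exact h j hj hi'
  have := Finset.card_le_univ (H ∪ H.map (addRightEmbedding 1))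
  rw [Finset.card_union_of_disjoint hd, Finset.card_map, ZMod.card] at this
  omega

/-- Otherwise the complement is sparse too, and two sets of size at most `t` would cover `2t + 1`
positions. Odd length thus forces a single one in every parse. -/
theorem IsSparse.exists_notMem {H : Finset (ZMod (2 * t + 1))} (h : IsSparse H) :
    ∃ i, i ∉ H ∧ i + 1 ∉ H := by
  by_contra! hcon
  have hc : IsSparse Hᶜ := fun i hi => by
    simpa using hcon i (by simpa using hi)
  have h₁ := h.card_le
  have h₂ := hc.card_le
  have h₃ := H.card_add_card_compl
  rw [ZMod.card] at h₃
  omega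

end CyclicWords

/-! ### Monomials of a box inside an ideal -/

namespace BoxPartition

variable {c : ℕ}

/-- The monomials of a box inside a monomial ideal with few generators. -/
theorem ideal (G : Finset (Fin n →₀ ℕ)) (u : Fin n →₀ ℕ) (Y : Finset (Fin n))
    (h : G = ∅ ∨ n + G.card / 2 ≤ Y.card + c) :
    BoxPartition c {d | d ∈ StanleyDepth.box u Y ∧ ∃ g ∈ G, g ≤ d} := by
  classical
  rcases G.eq_empty_or_nonempty with rfl | hG
  · simpa using BoxPartition.empty
  replace h := h.resolve_left hG.ne_empty
  obtain ⟨t, ht⟩ : ∃ t, t = G.card / 2 := ⟨_, rfl⟩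
  -- The cycle must have odd length, so `f` lists the generators with repetition when their number
  -- is even; `t = ⌊|G|/2⌋` is unaffected.
  obtain ⟨f, hf⟩ : ∃ f : ZMod (2 * t + 1) → G, Function.Surjective f := by
    have : Nonempty G := hG.to_subtype
    obtain ⟨e⟩ : Nonempty (G ↪ ZMod (2 * t + 1)) := by
      rw [Function.Embedding.nonempty_iff_card_le, ZMod.card, Fintype.card_coe]
      omega
    exact ⟨Function.invFun e, Function.invFun_surjective e.injective⟩
  have hex : ∀ d, (∃ g ∈ G, g ≤ d) ↔ ∃ i, (f i : Fin n →₀ ℕ) ≤ d := fun d =>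
    ⟨fun ⟨g, hg, hgd⟩ => by obtain ⟨i, hi⟩ := hf ⟨g, hg⟩; exact ⟨i, by rwa [hi]⟩,
      fun ⟨i, hi⟩ => ⟨_, (f i).2, hi⟩⟩
  have e : {d | d ∈ StanleyDepth.box u Y ∧ ∃ g ∈ G, g ≤ d} =
      ⋃ H ∈ Finset.univ.filter fun H : Finset (ZMod (2 * t + 1)) => IsSparse H,
        {d | d ∈ StanleyDepth.box u Y ∧ IsParse (fun i => (f i : Fin n →₀ ℕ) ≤ d) H} := by
    ext d
    simp only [hex, Set.mem_ofPred_eq, Set.mem_iUnion, Finset.mem_filter, Finset.mem_univ,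
      true_and, exists_prop]
    constructor
    · rintro ⟨hd, hb⟩
      obtain ⟨H, hH⟩ := exists_isParse hb
      exact ⟨H, (isParse_iff.1 hH).1, hd, hH⟩
    · rintro ⟨H, hH, hd, hp⟩
      obtain ⟨i, hi, hi'⟩ := hH.exists_notMem
      exact ⟨hd, i + 1, (isParse_iff.1 hp).2.1 i hi hi'⟩
  rw [e]
  refine biUnion _ _ (fun H hH => ?_) fun H hH H' hH' hne => ?_
  · simp only [Finset.mem_filter, Finset.mem_univ, true_and] at hH
    have hc : (H.image fun i => (f i : Fin n →₀ ℕ)).card ≤ t :=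
      Finset.card_image_le.trans hH.card_le
    -- Words with parse `H` avoid only the generators at positions in `H`, at most `t` of them.
    convert ge_and_avoid (c := c) ((Finset.univ.filter fun i => i ∉ H ∧ i + 1 ∉ H).image fun i =>
      (f (i + 1) : Fin n →₀ ℕ)) (H.image fun i => (f i : Fin n →₀ ℕ)) u Y (by omega) using 1
    ext d
    simp only [Set.mem_ofPred_eq, isParse_iff, hH, true_and, Finset.forall_mem_image,
      Finset.mem_filter, Finset.mem_univ, and_imp]
  · simp only [Finset.mem_filter, Finset.mem_univ, true_and] at hH
    rw [Set.disjoint_left]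
    rintro d ⟨-, hp⟩ ⟨-, hp'⟩
    obtain ⟨i, hi, hi'⟩ := hH.exists_notMem
    exact hne (hp.unique ⟨i + 1, (isParse_iff.1 hp).2.1 i hi hi'⟩ hp')

end BoxPartition

/-! ### Slicing along variables from associated primes -/

/-- Every proper colon ideal of `(x ^ g : g ∈ G)` by a monomial is contained in an ideal that is
generated by at most `k` variables. -/
def ColonsHitBy (k : ℕ) (G : Finset (Fin n →₀ ℕ)) : Prop :=
  ∀ w : Fin n →₀ ℕ, (∀ g ∈ G, ¬ g ≤ w) →
    ∃ P : Finset (Fin n), P.card ≤ k ∧ ∀ g ∈ G, ∃ i ∈ P, w i < g i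

/-- Pigeonhole over the at most `k` variables of a hitting set: the best one accounts for at least
`|G|/k` generators. The inequality is stated without division. -/
theorem ColonsHitBy.exists_card_filter_le {k : ℕ} {G : Finset (Fin n →₀ ℕ)}
    (h : ColonsHitBy k G) (hG : G.Nonempty) {w : Fin n →₀ ℕ} (hw : ∀ g ∈ G, ¬ g ≤ w) :
    ∃ i, (∃ g ∈ G, w i < g i) ∧
      k * (G.filter fun g => g i ≤ w i).card + G.card ≤ k * G.card := by
  classical
  obtain ⟨P, hP, hPG⟩ := h w hw
  have hsum : G.card ≤ ∑ i ∈ P, (G.filter fun g => w i < g i).card := by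
    refine le_trans (Finset.card_le_card fun g hg => ?_) Finset.card_biUnion_le
    obtain ⟨i, hi, hgi⟩ := hPG g hg
    simp only [Finset.mem_biUnion, Finset.mem_filter]
    exact ⟨i, hi, hg, hgi⟩
  have hPne : P.Nonempty := by
    obtain ⟨g, hg⟩ := hG
    obtain ⟨i, hi, -⟩ := hPG g hg
    exact ⟨i, hi⟩
  obtain ⟨i, hi, hmax⟩ := P.exists_max_image (fun i => (G.filter fun g => w i < g i).card) hPne
  have hle : G.card ≤ k * (G.filter fun g => w i < g i).card :=
    calc G.card ≤ ∑ i ∈ P, (G.filter fun g => w i < g i).card := hsum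
      _ ≤ P.card * (G.filter fun g => w i < g i).card := by
        simpa using Finset.sum_le_card_nsmul P _ _ hmax
      _ ≤ _ := Nat.mul_le_mul_right _ hP
  have hsplit := G.card_filter_add_card_filter_not (fun g => w i < g i)
  simp only [not_lt] at hsplit
  refine ⟨i, ?_, ?_⟩
  · have : (G.filter fun g => w i < g i).Nonempty := by
      rw [← Finset.card_pos]
      refine Nat.pos_of_ne_zero fun h0 => ?_
      have := hG.card_pos
      rw [h0, mul_zero] at hle
      omega
    obtain ⟨g, hg⟩ := this
    simp only [Finset.mem_filter] at hg
    exact ⟨g, hg⟩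
  · rw [← hsplit, mul_add]
    rw [← hsplit] at hle
    omega

namespace BoxPartition

variable {c k : ℕ} {G : Finset (Fin n →₀ ℕ)}

/-- Splitting off, as long as possible, a variable that divides many generators. -/
theorem of_colonsHitBy (hk : ColonsHitBy k G) (hG : G.Nonempty)
    (p : Prop → Prop)
    (hfull : ∀ u : Fin n →₀ ℕ, (∃ g ∈ G, g ≤ u) →
      BoxPartition c {d | d ∈ StanleyDepth.box u Finset.univ ∧ p (∃ g ∈ G, g ≤ d)})
    (hface : ∀ (u : Fin n →₀ ℕ) (i : Fin n) (G' : Finset (Fin n →₀ ℕ)), G' ⊆ G →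
      k * G'.card + G.card ≤ k * G.card →
      BoxPartition c {d | d ∈ StanleyDepth.box u (Finset.univ.erase i) ∧ p (∃ g ∈ G', g ≤ d)})
    (u : Fin n →₀ ℕ) :
    BoxPartition c {d | d ∈ StanleyDepth.box u Finset.univ ∧ p (∃ g ∈ G, g ≤ d)} := by
  classical
  -- The total deficit of `u` below the generators drops at each slice, because the chosen `i`
  -- satisfies `u i < g i` for some `g ∈ G`.
  induction hN : ∑ g ∈ G, ∑ i, (g i - u i) using Nat.strong_induction_on generalizing u with
  | _ N ihN =>
  by_cases hu : ∃ g ∈ G, g ≤ u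
  · exact hfull u hu
  · push Not at hu
    obtain ⟨i, ⟨g, hg, hgi⟩, hcard⟩ := hk.exists_card_filter_le hG hu
    have e : {d | d ∈ StanleyDepth.box u Finset.univ ∧ p (∃ g ∈ G, g ≤ d)} =
        {d | d ∈ StanleyDepth.box u (Finset.univ.erase i) ∧
          p (∃ g ∈ G.filter fun g => g i ≤ u i, g ≤ d)} ∪
        {d | d ∈ StanleyDepth.box (u + Finsupp.single i 1) Finset.univ ∧
          p (∃ g ∈ G, g ≤ d)} := by
      rw [box_eq_union (Finset.mem_univ i) u]
      ext d
      simp only [Set.mem_ofPred_eq, Set.mem_union, or_and_right]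
      refine or_congr_left (and_congr_right fun hd => ?_)
      have hdi := (hd i).2 (by simp)
      have : (∃ g ∈ G, g ≤ d) ↔ ∃ g ∈ G.filter fun g => g i ≤ u i, g ≤ d :=
        ⟨fun ⟨g, hg, hgd⟩ => ⟨g, Finset.mem_filter.2 ⟨hg, hdi ▸ hgd i⟩, hgd⟩,
          fun ⟨g, hg, hgd⟩ => ⟨g, (Finset.mem_filter.1 hg).1, hgd⟩⟩
      rw [this]
    rw [e]
    refine union _ _ (hface u i _ (Finset.filter_subset _ _) hcard) (ihN _ ?_ _ rfl) ?_
    · rw [← hN]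
      refine Finset.sum_lt_sum (fun g _ => Finset.sum_le_sum fun j _ => ?_)
        ⟨g, hg, Finset.sum_lt_sum (fun j _ => ?_) ⟨i, Finset.mem_univ i, ?_⟩⟩
      · simp only [Finsupp.add_apply]; omega
      · simp only [Finsupp.add_apply]; omega
      · simp only [Finsupp.add_apply, Finsupp.single_eq_same]; omega
    · exact (disjoint_box_erase _ i u).mono (fun d hd => hd.1) fun d hd => hd.1

/-- A slice has codimension 1 and at most `m'` relevant generators, so `avoid` gives codimension `m'
+ 1`; a box whose corner is in the ideal contributes nothing. -/
theorem compl_of_colonsHitBy (hk : ColonsHitBy k G) (hG : G.Nonempty)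
    (h : ∀ m' : ℕ, k * m' + G.card ≤ k * G.card → m' + 1 ≤ c) :
    BoxPartition c {d | ¬ ∃ g ∈ G, g ≤ d} := by
  have := of_colonsHitBy (c := c) hk hG Not ?_ ?_ 0
  · simpa [box_univ_zero] using this
  · rintro u ⟨g, hg, hgu⟩
    convert BoxPartition.empty
    rw [Set.eq_empty_iff_forall_notMem]
    rintro d ⟨hd, hd'⟩
    exact hd' ⟨g, hg, fun i => (hgu i).trans (hd i).1⟩
  · intro u i G' _ hG'
    have h₁ := Finset.card_erase_add_one (Finset.mem_univ i)
    rw [Finset.card_univ, Fintype.card_fin] at h₁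
    have := h _ hG'
    convert avoid (c := c) G' u (Finset.univ.erase i) (by omega) using 4
    push Not
    rfl

/-- A box whose corner is in the ideal is kept whole. A slice costs 1, plus `m' / 2` by `ideal`;
with no relevant generators it is empty and imposes no bound on `c`. -/
theorem ideal_of_colonsHitBy (hk : ColonsHitBy k G) (hG : G.Nonempty)
    (h : ∀ m' : ℕ, k * m' + G.card ≤ k * G.card → m' = 0 ∨ m' / 2 + 1 ≤ c) :
    BoxPartition c {d | ∃ g ∈ G, g ≤ d} := by
  have := of_colonsHitBy (c := c) hk hG id ?_ ?_ 0
  · simpa [box_univ_zero] using this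
  · rintro u ⟨g, hg, hgu⟩
    convert BoxPartition.box (c := c) u Finset.univ (by simp) using 1
    ext d
    simp only [Set.mem_ofPred_eq, id, and_iff_left_iff_imp]
    exact fun hd => ⟨g, hg, fun i => (hgu i).trans (hd i).1⟩
  · intro u i G' _ hG'
    have h₁ := Finset.card_erase_add_one (Finset.mem_univ i)
    rw [Finset.card_univ, Fintype.card_fin] at h₁
    refine ideal (c := c) G' u (Finset.univ.erase i) ?_
    rcases h _ hG' with h | h
    · exact Or.inl (Finset.card_eq_zero.1 h)
    · right; omega

end BoxPartition

/-! ### From box partitions to Stanley decompositions -/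

theorem mul_monomial_mem_restrictSupport_box {Z : Finset (Fin n)} {f : MvPolynomial (Fin n) K}
    (hf : f ∈ supported K (Z : Set (Fin n))) (a : Fin n →₀ ℕ) :
    f * monomial a 1 ∈ restrictSupport K (box a Z) := by
  rw [mem_restrictSupport_iff]
  intro d hd
  rw [Finset.mem_coe, mem_support_iff, coeff_mul_monomial'] at hd
  split_ifs at hd with had
  · rw [mul_one, ← mem_support_iff] at hd
    intro i
    refine ⟨had i, fun hi => ?_⟩
    by_contra hne
    have := had i
    refine hi (mem_supported.1 hf (mem_vars_iff_mem_support i |>.2 ⟨_, hd, ?_⟩))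
    rw [Finsupp.mem_support_iff, Finsupp.tsub_apply]
    omega
  · exact absurd rfl hd

theorem exists_mul_monomial_eq {Z : Finset (Fin n)} {a : Fin n →₀ ℕ}
    {p : MvPolynomial (Fin n) K} (hp : p ∈ restrictSupport K (box a Z)) :
    ∃ f ∈ supported K (Z : Set (Fin n)), f * monomial a 1 = p := by
  rw [restrictSupport_eq_span] at hp
  induction hp using Submodule.span_induction with
  | mem x hx =>
    obtain ⟨d, hd, rfl⟩ := hx
    refine ⟨monomial (d - a) 1, ?_, ?_⟩
    · rw [mem_supported]
      intro i hi
      rw [Finset.mem_coe, vars_monomial one_ne_zero, Finsupp.mem_support_iff,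
        Finsupp.tsub_apply] at hi
      by_contra hiZ
      have := (hd i).2 hiZ
      omega
    · rw [monomial_mul, one_mul, tsub_add_cancel_of_le fun i => (hd i).1]
  | zero => exact ⟨0, zero_mem _, zero_mul _⟩
  | add x y _ _ hx hy =>
    obtain ⟨f, hf, rfl⟩ := hx
    obtain ⟨g, hg, rfl⟩ := hy
    exact ⟨f + g, add_mem hf hg, add_mul _ _ _⟩
  | smul c x _ hx =>
    obtain ⟨f, hf, rfl⟩ := hx
    exact ⟨c • f, Subalgebra.smul_mem _ hf c, smul_mul_assoc _ _ _⟩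

theorem isInternal_restrictSupport {ι : Type*} [DecidableEq ι] {R : Set (Fin n →₀ ℕ)}
    (B : ι → Set (Fin n →₀ ℕ))
    (hB : ⋃ i, B i = R) (hd : Pairwise fun i j => Disjoint (B i) (B j)) :
    DirectSum.IsInternal fun i =>
      (restrictSupport K (B i)).comap (restrictSupport K R).subtype := by
  apply DirectSum.isInternal_submodule_of_iSupIndep_of_iSup_eq_top
  · intro i
    rw [Submodule.disjoint_def]
    intro x hx hx'
    -- The other pieces together are supported off `B i`, so a common element has empty support.
    have : (⨆ j, ⨆ (_ : j ≠ i), (restrictSupport K (B j)).comap (restrictSupport K R).subtype) ≤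
        (restrictSupport K (B i)ᶜ).comap (restrictSupport K R).subtype :=
      iSup₂_le fun j hj => Submodule.comap_mono (restrictSupport_mono K (hd hj).subset_compl_right)
    have hx'' := this hx'
    simp only [Submodule.mem_comap, Submodule.subtype_apply, mem_restrictSupport_iff] at hx hx''
    have hs : ((x : MvPolynomial (Fin n) K).support : Set (Fin n →₀ ℕ)) ⊆ ∅ := by
      rw [← Set.inter_compl_self (B i)]
      exact Set.subset_inter hx hx''
    have h0 : (x : MvPolynomial (Fin n) K) = 0 := by
      rw [← support_eq_empty, ← Finset.coe_eq_empty]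
      exact Set.subset_empty_iff.1 hs
    exact Subtype.ext h0
  · rw [eq_top_iff]
    rintro ⟨x, hx⟩ -
    have hmem : ∀ d (hd : d ∈ x.support), monomial d (coeff d x) ∈ restrictSupport K R :=
      fun d hd => (monomial_mem_restrictSupport K).2 (Or.inl (hx hd))
    have hsum : (⟨x, hx⟩ : restrictSupport K R) =
        ∑ d ∈ x.support.attach, ⟨monomial d.1 (coeff d.1 x), hmem d.1 d.2⟩ := by
      apply Subtype.ext
      rw [AddSubmonoidClass.coe_finsetSum]
      change x = _
      conv_lhs => rw [x.as_sum, ← Finset.sum_attach]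
    rw [hsum]
    refine Submodule.sum_mem _ fun d _ => ?_
    have hdR : d.1 ∈ R := hx d.2
    rw [← hB] at hdR
    obtain ⟨i, hi⟩ := Set.mem_iUnion.1 hdR
    refine Submodule.mem_iSup_of_mem i ?_
    simpa using Or.inl hi

theorem isInternal_map_equiv {ι M N : Type*} [DecidableEq ι] [AddCommGroup M] [Module K M]
    [AddCommGroup N] [Module K N] (e : M ≃ₗ[K] N) (A : ι → Submodule K M)
    (h : DirectSum.IsInternal A) : DirectSum.IsInternal fun i => (A i).map (e : M →ₗ[K] N) := by
  rw [DirectSum.isInternal_submodule_iff_iSupIndep_and_iSup_eq_top] at h ⊢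
  refine ⟨?_, ?_⟩
  · exact h.1.map_orderIso (Submodule.orderIsoMapComap e)
  · rw [← Submodule.map_iSup, h.2, Submodule.map_top, LinearEquiv.range]

section Modules

variable {M : Type*} [AddCommGroup M] [Module K M] [Module (MvPolynomial (Fin n) K) M]
  [IsScalarTower K (MvPolynomial (Fin n) K) M]

/-- A box partition of a monomial `K`-basis of `M` gives a Stanley decomposition of `M`. -/
theorem le_sdepth_of_boxPartition {ℳ : (Fin n → ℤ) → Submodule K M} {R : Set (Fin n →₀ ℕ)}
    {c : ℕ} (hR : BoxPartition c R) (e : restrictSupport K R ≃ₗ[K] M)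
    (hhom : ∀ d (x : restrictSupport K R), (x : MvPolynomial (Fin n) K) = monomial d 1 →
      ∃ a, e x ∈ ℳ a)
    (hsmul : ∀ (f : MvPolynomial (Fin n) K) (x y : restrictSupport K R),
      (y : MvPolynomial (Fin n) K) = f * x → f • e x = e y) :
    (n : ℕ∞) ≤ sdepth ℳ + c := by
  obtain ⟨r, a, Z, hc, hU, hd⟩ := hR.exists_fin
  have hsub : ∀ i, box (a i) (Z i) ⊆ R := fun i => hU ▸
    Set.subset_iUnion (fun i => box (a i) (Z i)) i
  have ha : ∀ i, monomial (a i) (1 : K) ∈ restrictSupport K R := fun i =>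
    (monomial_mem_restrictSupport K).2 (Or.inl (hsub i fun j => ⟨le_rfl, fun _ => rfl⟩))
  have hmul : ∀ i, ∀ f ∈ supported K (Z i : Set (Fin n)),
      f * monomial (a i) 1 ∈ restrictSupport K R := fun i f hf =>
    restrictSupport_mono K (hsub i) (mul_monomial_mem_restrictSupport_box hf _)
  have hspace : ∀ i, stanleySpace (K := K) (e ⟨_, ha i⟩) (Z i) =
      ((restrictSupport K (box (a i) (Z i))).comap (restrictSupport K R).subtype).map
        (e : restrictSupport K R →ₗ[K] M) := by
    intro i
    ext x
    simp only [stanleySpace, Submodule.mem_map, Subalgebra.mem_toSubmodule,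
      LinearMap.coe_restrictScalars, LinearMap.toSpanSingleton_apply, Submodule.mem_comap,
      Submodule.subtype_apply, LinearEquiv.coe_coe]
    constructor
    · rintro ⟨f, hf, rfl⟩
      exact ⟨⟨_, hmul i f hf⟩, mul_monomial_mem_restrictSupport_box hf _,
        (hsmul f ⟨_, ha i⟩ _ rfl).symm⟩
    · rintro ⟨y, hy, rfl⟩
      obtain ⟨f, hf, hfy⟩ := exists_mul_monomial_eq hy
      exact ⟨f, hf, hsmul f ⟨_, ha i⟩ y hfy.symm⟩
  let D : StanleyDecomposition ℳ :=
    { r := r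
      m := fun i => e ⟨_, ha i⟩
      Z := Z
      homogeneous := fun i => hhom _ _ rfl
      free := by
        rintro i ⟨f, hf⟩ ⟨g, hg⟩ hfg
        simp only [hsmul f ⟨_, ha i⟩ ⟨_, hmul i f hf⟩ rfl,
          hsmul g ⟨_, ha i⟩ ⟨_, hmul i g hg⟩ rfl, EmbeddingLike.apply_eq_iff_eq,
          Subtype.mk.injEq] at hfg
        exact Subtype.ext (mul_right_cancel₀ (by simp) hfg)
      isInternal := by
        simp only [hspace]
        exact isInternal_map_equiv e _ (isInternal_restrictSupport _ hU hd) }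
  have hD : ((n - c : ℕ) : ℕ∞) ≤ sdepth ℳ := by
    refine le_trans (le_iInf fun i => ?_) (le_iSup (fun D => StanleyDecomposition.sdepth D) D)
    have := hc i
    exact_mod_cast (by omega : n - c ≤ (Z i).card)
  calc (n : ℕ∞) ≤ ((n - c : ℕ) : ℕ∞) + c := by exact_mod_cast (by omega : n ≤ n - c + c)
    _ ≤ _ := by gcongr

end Modules

theorem mem_monomialSpan_iff {G : Finset (Fin n →₀ ℕ)} {p : MvPolynomial (Fin n) K} :
    p ∈ monomialSpan K G ↔ p ∈ restrictSupport K {d | ∃ g ∈ G, g ≤ d} := by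
  rw [monomialSpan, mem_ideal_span_monomial_image, mem_restrictSupport_iff]
  rfl

theorem monomial_mem_fineGrading (d : Fin n →₀ ℕ) :
    monomial d (1 : K) ∈ fineGrading n K fun i => (d i : ℤ) := by
  intro d' hd' i
  classical
  rw [coeff_monomial] at hd'
  split_ifs at hd' with h
  · rw [h]
  · exact absurd rfl hd'

theorem le_sdepth_ideal {G : Finset (Fin n →₀ ℕ)} {c : ℕ}
    (h : BoxPartition c {d | ∃ g ∈ G, g ≤ d}) :
    (n : ℕ∞) ≤ sdepth (idealGrading (monomialSpan K G)) + c := by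
  let e : restrictSupport K {d | ∃ g ∈ G, g ≤ d} ≃ₗ[K] monomialSpan K G :=
    { toFun := fun x => ⟨x.1, mem_monomialSpan_iff.2 x.2⟩
      invFun := fun x => ⟨x.1, mem_monomialSpan_iff.1 x.2⟩
      map_add' := fun _ _ => rfl
      map_smul' := fun _ _ => rfl
      left_inv := fun _ => rfl
      right_inv := fun _ => rfl }
  refine le_sdepth_of_boxPartition h e ?_ ?_
  · intro d x hx
    refine ⟨fun i => (d i : ℤ), ?_⟩
    change (x : MvPolynomial (Fin n) K) ∈ fineGrading n K _
    rw [hx]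
    exact monomial_mem_fineGrading d
  · intro f x y hxy
    exact Subtype.ext hxy.symm

theorem le_sdepth_quotient {G : Finset (Fin n →₀ ℕ)} {c : ℕ}
    (h : BoxPartition c {d | ¬ ∃ g ∈ G, g ≤ d}) :
    (n : ℕ∞) ≤ sdepth (quotientGrading (monomialSpan K G)) + c := by
  let φ : restrictSupport K {d | ¬ ∃ g ∈ G, g ≤ d} →ₗ[K]
      MvPolynomial (Fin n) K ⧸ monomialSpan K G :=
    (Ideal.Quotient.mkₐ K (monomialSpan K G)).toLinearMap ∘ₗ Submodule.subtype _
  have hφ : ∀ x, φ x = Ideal.Quotient.mk (monomialSpan K G) x.1 := fun _ => rfl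
  have hinj : Function.Injective φ := by
    rw [← LinearMap.ker_eq_bot, LinearMap.ker_eq_bot']
    intro x hx
    rw [hφ, Ideal.Quotient.eq_zero_iff_mem, mem_monomialSpan_iff, mem_restrictSupport_iff] at hx
    apply Subtype.ext
    rw [ZeroMemClass.coe_zero, ← support_eq_empty, Finset.eq_empty_iff_forall_notMem]
    exact fun d hd => x.2 hd (hx hd)
  have hsurj : Function.Surjective φ := by
    intro y
    obtain ⟨p, rfl⟩ := Ideal.Quotient.mk_surjective y
    change Ideal.Quotient.mk (monomialSpan K G) p ∈ LinearMap.range φ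
    induction p using MvPolynomial.induction_on' with
    | monomial d a =>
      by_cases hd : ∃ g ∈ G, g ≤ d
      · rw [Ideal.Quotient.eq_zero_iff_mem.2
          (mem_monomialSpan_iff.2 ((monomial_mem_restrictSupport K).2 (Or.inl hd)))]
        exact zero_mem _
      · exact ⟨⟨monomial d a, (monomial_mem_restrictSupport K).2 (Or.inl hd)⟩, rfl⟩
    | add p q hp hq =>
      rw [map_add]
      exact add_mem hp hq
  let e := LinearEquiv.ofBijective φ ⟨hinj, hsurj⟩
  refine le_sdepth_of_boxPartition h e ?_ ?_
  · intro d x hx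
    refine ⟨fun i => (d i : ℤ), monomial d 1, monomial_mem_fineGrading d, ?_⟩
    rw [← hx]
    rfl
  · intro f x y hxy
    change f • φ x = φ y
    rw [hφ, hφ, hxy]
    rfl

/-! ### Heights of primes generated by variables; associated primes -/

/-- The ideal is the kernel of the substitution that sends the variables in `T` to zero, an
endomorphism of a domain. -/
theorem isPrime_span_X_image (T : Finset (Fin n)) :
    (Ideal.span (X '' (T : Set (Fin n))) : Ideal (MvPolynomial (Fin n) K)).IsPrime := by
  classical
  let φ : MvPolynomial (Fin n) K →ₐ[K] MvPolynomial (Fin n) K :=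
    aeval fun i => if i ∈ T then 0 else X i
  have hsub : ∀ p,
      p - φ p ∈ Ideal.span (X '' (T : Set (Fin n)) : Set (MvPolynomial (Fin n) K)) := by
    intro p
    rw [← Ideal.Quotient.mk_eq_mk_iff_sub_mem]
    have : (Ideal.Quotient.mkₐ K (Ideal.span (X '' (T : Set (Fin n))
        : Set (MvPolynomial (Fin n) K)))) =
        (Ideal.Quotient.mkₐ K (Ideal.span (X '' (T : Set (Fin n))))).comp φ := by
      refine algHom_ext fun i => ?_
      by_cases hi : i ∈ T
      · have : (X i : MvPolynomial (Fin n) K) ∈ Ideal.span (X '' (T : Set (Fin n))) :=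
          Ideal.subset_span ⟨i, hi, rfl⟩
        simpa [φ, hi] using Ideal.Quotient.eq_zero_iff_mem.2 this
      · simp [φ, hi]
    exact DFunLike.congr_fun this p
  have : Ideal.span (X '' (T : Set (Fin n))) = RingHom.ker φ := by
    apply le_antisymm
    · rw [Ideal.span_le]
      rintro _ ⟨i, hi, rfl⟩
      have hi' : i ∈ T := hi
      simp [φ, RingHom.mem_ker, hi']
    · intro p hp
      have := hsub p
      rwa [RingHom.mem_ker.1 hp, sub_zero] at this
  rw [this]
  exact RingHom.ker_isPrime φ

theorem card_le_height_span_X_image (T : Finset (Fin n)) :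
    (T.card : ℕ∞) ≤
      (Ideal.span (X '' (T : Set (Fin n))) : Ideal (MvPolynomial (Fin n) K)).height := by
  classical
  induction T using Finset.induction_on with
  | empty => simp
  | insert i T hi ih =>
    have h₁ := isPrime_span_X_image (K := K) T
    have h₂ := isPrime_span_X_image (K := K) (insert i T)
    rw [Finset.card_insert_of_notMem hi]
    rw [Finset.coe_insert] at h₂
    push_cast
    refine le_trans (by gcongr) (Ideal.height_add_one_le_of_lt_of_isPrime
      (I := Ideal.span (X '' (T : Set (Fin n)))) ?_)
    rw [Set.image_insert_eq]
    refine lt_of_le_of_ne (Ideal.span_mono (Set.subset_insert _ _)) fun h => ?_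
    have hX : (X i : MvPolynomial (Fin n) K) ∈ Ideal.span (X '' (T : Set (Fin n))) := by
      rw [h]; exact Ideal.subset_span (Set.mem_insert _ _)
    rw [mem_ideal_span_X_image] at hX
    obtain ⟨j, hj, hj'⟩ := hX (Finsupp.single i 1) (by simp [support_X])
    rw [Finsupp.single_apply] at hj'
    split_ifs at hj' with hij
    · exact hi (hij ▸ hj)
    · exact hj' rfl

theorem exists_isAssociatedPrime_of_notMem {A : Type*} [CommRing A] [IsNoetherianRing A]
    (I : Ideal A) {w : A}
    (hw : w ∉ I) : ∃ P ∈ associatedPrimes A (A ⧸ I), ∀ a, a * w ∈ I → a ∈ P := by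
  have h0 : (Ideal.Quotient.mk I w) ≠ 0 := fun h => hw (Ideal.Quotient.eq_zero_iff_mem.1 h)
  obtain ⟨P, hP, hle⟩ := exists_le_isAssociatedPrime_of_isNoetherianRing A _ h0
  refine ⟨P, hP, fun a ha => hle ?_⟩
  rw [Submodule.mem_colon_singleton, Submodule.mem_bot]
  exact Ideal.Quotient.eq_zero_iff_mem.2 ha

/-! ### Depth of an ideal and of its quotient -/

open CategoryTheory Abelian RingTheory.Sequence in
/-- The depth lemma for an ideal and its quotient ring, in terms of regular sequences. -/
theorem exists_isRegular_quotient {A : Type*} [CommRing A] [IsNoetherianRing A] (J I : Ideal A)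
    (t : ℕ) (hA : J • (⊤ : Submodule A A) < ⊤) (hI : J • (⊤ : Submodule A I) < ⊤)
    (hQ : J • (⊤ : Submodule A (A ⧸ I)) < ⊤)
    (h₁ : ∃ rs : List A, t + 1 ≤ rs.length ∧ (∀ r ∈ rs, r ∈ J) ∧ IsRegular I rs)
    (h₂ : ∃ rs : List A, t ≤ rs.length ∧ (∀ r ∈ rs, r ∈ J) ∧ IsRegular A rs) :
    ∃ rs : List A, rs.length = t ∧ (∀ r ∈ rs, r ∈ J) ∧ IsRegular (A ⧸ I) rs := by
  obtain ⟨rs₁, l₁, m₁, r₁⟩ := h₁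
  obtain ⟨rs₂, l₂, m₂, r₂⟩ := h₂
  have h₁ : ∃ rs : List A, rs.length = rs₁.length ∧ (∀ r ∈ rs, r ∈ J) ∧ IsRegular I rs :=
    ⟨rs₁, rfl, m₁, r₁⟩
  have h₂ : ∃ rs : List A, rs.length = rs₂.length ∧ (∀ r ∈ rs, r ∈ J) ∧ IsRegular A rs :=
    ⟨rs₂, rfl, m₂, r₂⟩
  have e₁ := ((ModuleCat.exists_isRegular_tfae J _ (ModuleCat.of A I) hI).out 3 1).1 h₁
  have e₂ := ((ModuleCat.exists_isRegular_tfae J _ (ModuleCat.of A A) hA).out 3 1).1 h₂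
  refine ((ModuleCat.exists_isRegular_tfae J t (ModuleCat.of A (A ⧸ I)) hQ).out 1 3).1 ?_
  let S : ShortComplex (ModuleCat A) := ShortComplex.mk
    (ModuleCat.ofHom (Submodule.subtype I)) (ModuleCat.ofHom (Submodule.mkQ I)) (by
      ext x
      exact Ideal.Quotient.eq_zero_iff_mem.2 x.2)
  have hS : S.ShortExact :=
    { exact := (ShortComplex.ShortExact.moduleCat_exact_iff_function_exact S).2 (by
        exact LinearMap.exact_subtype_mkQ I)
      mono_f := (ModuleCat.mono_iff_injective _).2 (Submodule.injective_subtype I)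
      epi_g := (ModuleCat.epi_iff_surjective _).2 (Submodule.mkQ_surjective I) }
  intro i hi
  have z₁ := AddCommGrpCat.isZero_of_iff_subsingleton.mpr (e₁ (i + 1) (by omega))
  have z₂ := AddCommGrpCat.isZero_of_iff_subsingleton.mpr (e₂ i (by omega))
  -- In the long exact sequence, `Ext^i` into `A ⧸ I` sits between `Ext^i` into `A` and `Ext^(i+1)`
  -- into `I`, both zero here.
  exact AddCommGrpCat.subsingleton_of_isZero <| ShortComplex.Exact.isZero_of_both_zeros
    (Ext.covariant_sequence_exact₃' _ hS i (i + 1) rfl)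
    (z₂.eq_zero_of_src _) (z₁.eq_zero_of_tgt _)

theorem idealOfVars_ne_top : idealOfVars (Fin n) K ≠ ⊤ := by
  intro h
  have h1 : (1 : MvPolynomial (Fin n) K) ∈ idealOfVars (Fin n) K := h ▸ Submodule.mem_top
  have hle : idealOfVars (Fin n) K ≤ RingHom.ker (constantCoeff (R := K) (σ := Fin n)) := by
    rw [idealOfVars, Ideal.span_le]
    rintro _ ⟨i, rfl⟩
    simp [RingHom.mem_ker]
  simpa [RingHom.mem_ker] using hle h1

theorem ofList_take_ofFn_X (i : ℕ) :
    Ideal.ofList ((List.ofFn (X : Fin n → MvPolynomial (Fin n) K)).take i) =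
      Ideal.span (X '' {j : Fin n | (j : ℕ) < i}) := by
  rw [Ideal.ofList]
  congr 1
  ext f
  simp only [Set.mem_ofPred_eq, Set.mem_image, List.mem_take_iff_getElem, List.getElem_ofFn,
    List.length_ofFn]
  constructor
  · rintro ⟨j, hj, rfl⟩
    exact ⟨⟨j, by omega⟩, by simp; omega, rfl⟩
  · rintro ⟨j, hj, rfl⟩
    exact ⟨j, by have := j.2; omega, rfl⟩

theorem isRegular_ofFn_X : RingTheory.Sequence.IsRegular (MvPolynomial (Fin n) K)
    (List.ofFn (X : Fin n → MvPolynomial (Fin n) K)) where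
  regular_mod_prev := by
    intro i hi
    rw [List.length_ofFn] at hi
    rw [isSMulRegular_quotient_iff_mem_of_smul_mem, ofList_take_ofFn_X]
    simp only [smul_eq_mul, Ideal.mul_top, List.getElem_ofFn]
    intro f hf
    rw [mem_ideal_span_X_image] at hf ⊢
    intro d hd
    obtain ⟨j, hj, hj'⟩ := hf (Finsupp.single ⟨i, hi⟩ 1 + d) (by
      rw [mem_support_iff, coeff_X_mul]
      exact mem_support_iff.1 hd)
    refine ⟨j, hj, ?_⟩
    have hne : (⟨i, hi⟩ : Fin n) ≠ j := by
      rintro rfl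
      exact lt_irrefl i hj
    simpa [Finsupp.single_apply, hne] using hj'
  top_ne_smul := by
    intro h
    rw [smul_eq_mul, Ideal.mul_top] at h
    refine idealOfVars_ne_top (n := n) (K := K) ?_
    rw [h, idealOfVars, Ideal.ofList]
    congr 1
    ext f
    simp

/-- By Nakayama, equality would give some `r ≡ 1` modulo `J` killing `I ≠ 0`; in a domain `r = 0`,
so `1 ∈ J`. -/
theorem smul_top_ideal_lt_top {A : Type*} [CommRing A] [IsDomain A] [IsNoetherianRing A]
    {J I : Ideal A} (hJ : J ≠ ⊤) (hI : I ≠ ⊥) : J • (⊤ : Submodule A I) < ⊤ := by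
  rw [lt_top_iff_ne_top]
  intro h
  obtain ⟨r, hr, hr'⟩ := Submodule.exists_sub_one_mem_and_smul_eq_zero_of_fg_of_le_smul J
    (⊤ : Submodule A I) (Module.Finite.fg_top) h.ge
  obtain ⟨x, hx, hx0⟩ := Submodule.exists_mem_ne_zero_of_ne_bot hI
  have := congrArg Subtype.val (hr' ⟨x, hx⟩ trivial)
  simp only [SetLike.val_smul, smul_eq_mul, ZeroMemClass.coe_zero, mul_eq_zero, hx0,
    or_false] at this
  rw [this, zero_sub] at hr
  exact hJ ((Ideal.eq_top_iff_one J).2 (by simpa using J.neg_mem hr))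

theorem smul_top_quotient_lt_top {A : Type*} [CommRing A]
    {J I : Ideal A} (hJ : J ≠ ⊤) (hI : I ≤ J) : J • (⊤ : Submodule A (A ⧸ I)) < ⊤ := by
  rw [lt_top_iff_ne_top]
  intro h
  have hmap : J • (⊤ : Submodule A (A ⧸ I)) = Submodule.map (Submodule.mkQ I) J := by
    rw [← Submodule.range_mkQ I, ← Submodule.map_top, ← Submodule.map_smul'', smul_eq_mul,
      Ideal.mul_top]
  rw [hmap, ← Submodule.range_mkQ I, ← Submodule.map_top] at h
  have h' := congrArg (Submodule.comap (Submodule.mkQ I)) h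
  rw [Submodule.comap_map_mkQ, Submodule.comap_map_mkQ, sup_eq_right.2 hI, sup_top_eq] at h'
  exact hJ h'

/-- If `S ⧸ I` does not have the maximal depth `n`, then `depth I ≤ depth (S ⧸ I) + 1`. -/
theorem depth_ideal_le {I : Ideal (MvPolynomial (Fin n) K)} (hI₀ : I ≠ ⊥)
    (hI : I ≤ idealOfVars (Fin n) K)
    (h : depth n K (MvPolynomial (Fin n) K ⧸ I) + 1 ≤ n) :
    depth n K I ≤ depth n K (MvPolynomial (Fin n) K ⧸ I) + 1 := by
  obtain ⟨e, he⟩ : ∃ e : ℕ, depth n K (MvPolynomial (Fin n) K ⧸ I) = e := by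
    refine ⟨_, (ENat.natCast_toNat ?_).symm⟩
    rintro htop
    rw [htop] at h
    simp at h
  rw [he] at h ⊢
  refine iSup_le fun rs => iSup_le fun hmem => iSup_le fun hreg => ?_
  by_contra hlt
  have hlt' : e + 2 ≤ rs.length := by
    rw [not_le] at hlt
    have : e + 1 < rs.length := by exact_mod_cast hlt
    omega
  have hn : e + 1 ≤ n := by exact_mod_cast h
  have htop := idealOfVars_ne_top (n := n) (K := K)
  -- A regular sequence on `I` of length `e + 2`, with the `n ≥ e + 1` variables on `S`, would
  -- produce one of length `e + 1` on `S ⧸ I`, whose depth is `e`.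
  obtain ⟨rs', hl, hm, hr⟩ := exists_isRegular_quotient (idealOfVars (Fin n) K) I (e + 1)
    (by simpa [lt_top_iff_ne_top] using htop) (smul_top_ideal_lt_top htop hI₀)
    (smul_top_quotient_lt_top htop hI) ⟨rs, hlt', hmem, hreg⟩
    ⟨_, by simpa using hn, fun r hr => by
      obtain ⟨i, rfl⟩ := (List.mem_ofFn' _ _).1 hr
      exact Ideal.subset_span ⟨i, rfl⟩, isRegular_ofFn_X⟩
  have : ((e + 1 : ℕ) : ℕ∞) ≤ e := by
    rw [← he, ← hl]
    exact le_iSup_of_le rs' (le_iSup_of_le hm (le_iSup_of_le hr le_rfl))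
  have : e + 1 ≤ e := by exact_mod_cast this
  omega

/-! ### From heights to hitting sets -/

/-- An associated prime `Q` contains the colon ideal by `x^w`, in particular each `x^(g-w)`, hence a
variable `x_i` with `w_i < g_i`. The variables in `Q` generate a prime inside `Q`, so there are at
most `k` of them. -/
theorem colonsHitBy_of_height_le {G : Finset (Fin n →₀ ℕ)} {k : ℕ}
    (hk : ∀ P ∈ associatedPrimes (MvPolynomial (Fin n) K)
      (MvPolynomial (Fin n) K ⧸ monomialSpan K G), P.height ≤ k) : ColonsHitBy k G := by
  classical
  intro w hw
  have hwI : monomial w (1 : K) ∉ monomialSpan K G := by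
    rw [mem_monomialSpan_iff, monomial_mem_restrictSupport]
    rintro (⟨g, hg, hgw⟩ | h)
    · exact hw g hg hgw
    · exact one_ne_zero h
  obtain ⟨Q, hQ, hcol⟩ := exists_isAssociatedPrime_of_notMem _ hwI
  have hQp : Q.IsPrime := hQ.isPrime
  refine ⟨Finset.univ.filter fun i => X i ∈ Q, ?_, fun g hg => ?_⟩
  · have h₁ := card_le_height_span_X_image (K := K) (Finset.univ.filter fun i => X i ∈ Q)
    have h₂ : Ideal.span (X '' ((Finset.univ.filter fun i => X i ∈ Q : Finset (Fin n)) :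
        Set (Fin n))) ≤ Q := by
      rw [Ideal.span_le]
      rintro _ ⟨i, hi, rfl⟩
      simpa using hi
    exact_mod_cast h₁.trans ((Ideal.height_mono h₂).trans (hk Q hQ))
  · have hmem : monomial (g - w) (1 : K) ∈ Q := by
      refine hcol _ ?_
      rw [monomial_mul, mem_monomialSpan_iff, monomial_mem_restrictSupport]
      exact Or.inl ⟨g, hg, le_tsub_add⟩
    rw [monomial_eq, C_1, one_mul, Finsupp.prod, hQp.prod_mem_iff] at hmem
    obtain ⟨i, hi, hiQ⟩ := hmem
    refine ⟨i, by simpa using hQp.mem_of_pow_mem _ hiQ, ?_⟩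
    rw [Finsupp.mem_support_iff, Finsupp.tsub_apply] at hi
    omega

theorem monomialSpan_le_idealOfVars {G : Finset (Fin n →₀ ℕ)} (h : monomialSpan K G ≠ ⊤) :
    monomialSpan K G ≤ idealOfVars (Fin n) K := by
  intro p hp
  rw [idealOfVars, ← Set.image_univ, mem_ideal_span_X_image]
  intro d hd
  obtain ⟨g, hg, hgd⟩ := mem_monomialSpan_iff.1 hp hd
  by_contra! hcon
  refine h ((Ideal.eq_top_iff_one _).2 (Ideal.subset_span ⟨g, hg, ?_⟩))
  have : g = 0 := by
    ext i
    have := hgd i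
    rw [hcon i trivial] at this
    simpa using this
  rw [this]
  rfl

/-! ### Numerical bounds -/

theorem generators_bound_quotient {k m s : ℕ} (hs : k ≤ s) (hm : 0 < m)
    (h : k = 1 ∨ (m : ℤ) ≤ (s : ℤ) - 1 + ⌈(s : ℚ) / ((k : ℚ) - 1)⌉)
    (m' : ℕ) (hm' : k * m' + m ≤ k * m) : m' + 1 ≤ s := by
  rcases h with rfl | h
  · omega
  · obtain rfl | rfl | ⟨j, rfl⟩ : k = 0 ∨ k = 1 ∨ ∃ j, k = j + 2 := by
      rcases k with _ | _ | j
      · simp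
      · simp
      · exact Or.inr (Or.inr ⟨j, rfl⟩)
    · omega
    · omega
    -- An integer lies below `⌈x⌉` exactly when it lies below `x`, so the bound becomes `m(k-1) <
    -- sk`; combined with `k m' ≤ (k-1) m` it yields `m' < s`.
    · have h' : ((m : ℤ) - s) < ⌈(s : ℚ) / (((j + 2 : ℕ) : ℚ) - 1)⌉ := by omega
      rw [Int.lt_ceil, lt_div_iff₀ (by push_cast; linarith [(Nat.cast_nonneg j : (0 : ℚ) ≤ j)])]
        at h'
      push_cast at h'
      have h₂ : (m * (j + 1) : ℚ) < s * (j + 2) := by linarith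
      have h₃ : m * (j + 1) < s * (j + 2) := by exact_mod_cast h₂
      have h₄ : (j + 2) * m' < (j + 2) * s := by nlinarith
      exact lt_of_mul_lt_mul_left h₄ (Nat.zero_le _)

theorem generators_bound_ideal {k m s : ℕ} (hs : k ≤ s) (hm : 0 < m)
    (h : k = 1 ∨ (m : ℤ) ≤ 2 * (s : ℤ) - 3 + ⌈(2 * (s : ℚ) - 2) / ((k : ℚ) - 1)⌉)
    (m' : ℕ) (hm' : k * m' + m ≤ k * m) : m' = 0 ∨ m' / 2 + 1 ≤ s - 1 := by
  rcases h with rfl | h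
  · omega
  · obtain rfl | rfl | ⟨j, rfl⟩ : k = 0 ∨ k = 1 ∨ ∃ j, k = j + 2 := by
      rcases k with _ | _ | j
      · simp
      · simp
      · exact Or.inr (Or.inr ⟨j, rfl⟩)
    · omega
    · omega
    · obtain ⟨q, rfl⟩ : ∃ q, s = q + 1 := ⟨s - 1, by omega⟩
      -- Condition (2) is condition (1) with `2(s-1)` in place of `s`; hence `m' < 2(s-1)`, which is
      -- then halved.
      have := generators_bound_quotient (k := j + 2) (s := 2 * q) (by omega) hm
        (Or.inr (by
          have e : 2 * (((q + 1 : ℕ)) : ℚ) - 2 = ((2 * q : ℕ) : ℚ) := by push_cast; ring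
          rw [e] at h
          push_cast at h ⊢
          linarith)) m' hm'
      right
      omega

/-- Guards the truncated `s - 1`: for `s = k = 0` the fraction evaluates to 2 and the bound would
read `m ≤ -1`. -/
theorem one_le_of_generators_bound_ideal {k m s : ℕ} (hs : k ≤ s)
    (h : k = 1 ∨ (m : ℤ) ≤ 2 * (s : ℤ) - 3 + ⌈(2 * (s : ℚ) - 2) / ((k : ℚ) - 1)⌉) :
    1 ≤ s := by
  by_contra hs0
  obtain rfl : s = 0 := by omega
  obtain rfl : k = 0 := by omega
  norm_num at h
  omega

end StanleyDepth

end

theorem mainTheorem2 {K : Type*} [Field K] (n : ℕ) (I : Ideal (MvPolynomial (Fin n) K))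
    (hI₀ : I ≠ ⊥) (hI₁ : I ≠ ⊤)
    (m : ℕ) (hm : ∃ G : Finset (Fin n →₀ ℕ),
      StanleyDepth.IsMinimallyGeneratedBy I G ∧ G.card = m)
    (k : ℕ) (hk : IsGreatest
      {h : ℕ∞ | ∃ P ∈ associatedPrimes (MvPolynomial (Fin n) K) (MvPolynomial (Fin n) K ⧸ I),
        P.height = h} (k : ℕ∞))
    (s : ℕ) (hs : k ≤ s) :
    ((k = 1 ∨ (m : ℤ) ≤ (s : ℤ) - 1 + ⌈(s : ℚ) / ((k : ℚ) - 1)⌉) →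
      (n : ℕ∞) ≤ StanleyDepth.sdepth (StanleyDepth.quotientGrading I) + s) ∧
    ((k = 1 ∨ (m : ℤ) ≤ 2 * (s : ℤ) - 3 + ⌈(2 * (s : ℚ) - 2) / ((k : ℚ) - 1)⌉) →
      (n : ℕ∞) + 1 ≤ StanleyDepth.sdepth (StanleyDepth.idealGrading I) + s) ∧
    (StanleyDepth.depth n K (MvPolynomial (Fin n) K ⧸ I) + s = n →
      ((k = 1 ∨ (m : ℤ) ≤ (s : ℤ) - 1 + ⌈(s : ℚ) / ((k : ℚ) - 1)⌉) →
        StanleyDepth.depth n K (MvPolynomial (Fin n) K ⧸ I) ≤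
          StanleyDepth.sdepth (StanleyDepth.quotientGrading I)) ∧
      ((k = 1 ∨ (m : ℤ) ≤ 2 * (s : ℤ) - 3 + ⌈(2 * (s : ℚ) - 2) / ((k : ℚ) - 1)⌉) →
        StanleyDepth.depth n K I ≤ StanleyDepth.sdepth (StanleyDepth.idealGrading I))) := by
  obtain ⟨G, ⟨rfl, -⟩, rfl⟩ := hm
  have hG : G.Nonempty := by
    rw [Finset.nonempty_iff_ne_empty]
    rintro rfl
    exact hI₀ (by simp [StanleyDepth.monomialSpan])
  have hhit : StanleyDepth.ColonsHitBy k G :=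
    StanleyDepth.colonsHitBy_of_height_le fun P hP => hk.2 ⟨P, hP, rfl⟩
  have hquot := fun h => StanleyDepth.le_sdepth_quotient (K := K)
    (StanleyDepth.BoxPartition.compl_of_colonsHitBy (c := s) hhit hG
      (StanleyDepth.generators_bound_quotient hs hG.card_pos h))
  have hideal : (k = 1 ∨ (G.card : ℤ) ≤
      2 * (s : ℤ) - 3 + ⌈(2 * (s : ℚ) - 2) / ((k : ℚ) - 1)⌉) →
      (n : ℕ∞) + 1 ≤
        StanleyDepth.sdepth (StanleyDepth.idealGrading (StanleyDepth.monomialSpan K G)) + s := by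
    intro h
    have hs1 : s - 1 + 1 = s :=
      Nat.sub_add_cancel (StanleyDepth.one_le_of_generators_bound_ideal hs h)
    have := StanleyDepth.le_sdepth_ideal (K := K)
      (StanleyDepth.BoxPartition.ideal_of_colonsHitBy (c := s - 1) hhit hG
        (StanleyDepth.generators_bound_ideal hs hG.card_pos h))
    rw [← hs1, Nat.cast_add, Nat.cast_one, ← add_assoc]
    gcongr
  refine ⟨hquot, hideal, fun hdepth => ⟨fun h => ?_, fun h => ?_⟩⟩
  · have := hquot h
    rw [← hdepth] at this
    exact (ENat.add_le_add_iff_right (ENat.natCast_ne_top s)).1 this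
  · have hs1 : (1 : ℕ∞) ≤ s := by
      exact_mod_cast StanleyDepth.one_le_of_generators_bound_ideal hs h
    refine (StanleyDepth.depth_ideal_le hI₀
      (StanleyDepth.monomialSpan_le_idealOfVars hI₁) ?_).trans ?_
    · rw [← hdepth]
      gcongr
    · have := hideal h
      rw [← hdepth, add_right_comm] at this
      exact (ENat.add_le_add_iff_right (ENat.natCast_ne_top s)).1 this
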